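/- Let $p$ be an odd prime, $|\cdot|$ the $p$-adic absolute value on $\mathbb{Q}_p$, and $c\in\mathbb{Q}_p$ with $|c|>1$. Let $f(x,y)=(xy+c,x)$ on $\mathbb{Q}_p^2$, and $f^{-1}(x,y)=\left(y,\frac{x-c}{y}\right)$ for $y\neq 0$. Let $\mathsf{Q}$ be the set of points $(x,y)\in\mathbb{Q}_p^2$ for which $f^{-n}(x,y)$ is defined for all $n\ge 1$ (that is, $y\ne 0$ and all the points $f^{-n}(x,y)$, $n\geq 1$, have nonzero second coordinate), and let $\mathcal{K}^-$ be the set of $(x,y)\in\mathsf{Q}$ such that the sequence $(f^{-n}(x,y))_{n\ge1}$ is bounded. Let $F_0=F_1=1$ and $F_n=F_{n-1}+F_{n-2}$ for $n\ge2$. Put $$\mathsf{J}_0=\{(x,y)\in\mathsf{Q}: |x|<|c|,\ 1<|y|<|c|\},$$ $$\mathsf{C}_0=\{(x,y)\in\mathsf{Q}: |x|<|c| \text{ and } (|y|=1 \text{ or } |y|=|c|)\}\cup\{(x,y)\in\mathsf{Q}: |x|=|c| \text{ and } |y|\le|c|\},$$ $$\mathsf{D}_2=\{(x,y)\in\mathsf{Q}: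 |c|<|x|<|c|^2 \text{ and } |y|=|c|\},$$ for $n\ge0$, $$\mathsf{C}_{2n+1}=\{(x,y)\in\mathsf{Q}: |c|^{F_{2n}}<|x|\le|c|^{F_{2n+2}} \text{ and } |y|=(|c|^{-1}|x|^{F_{2n}})^{1/F_{2n+1}}\},$$ $$\mathsf{C}_{2n+2}=\{(x,y)\in\mathsf{Q}: |c|^{F_{2n+1}}<|x|\le|c|^{F_{2n+3}} \text{ and } |y|=(|c||x|^{F_{2n+1}})^{1/F_{2n+2}}\},$$ for $n\ge1$, $$\mathsf{D}_{2n+1}=\{(x,y)\in\mathsf{Q}: |c|^{F_{2n}}<|x|<|c|^{F_{2n+1}} \text{ and } |y|=(|c|^{-1}|x|^{F_{2n-2}})^{1/F_{2n-1}}\},$$ $$\mathsf{D}_{2n+2}=\{(x,y)\in\mathsf{Q}: |c|^{F_{2n+1}}<|x|<|c|^{F_{2n+2}} \text{ and } |y|=(|c||x|^{F_{2n-1}})^{1/F_{2n}}\},$$ and $\mathsf{C}=\bigcup_{i\ge0}(\mathsf{C}_i\cup\mathsf{D}_{i+2})$. Then: (a) $\mathsf{Q}\cap\bigcup_{n\ge0}f^n(\mathsf{J}_0)\subset\mathcal{K}^-\subset\mathsf{C}\cup\Big(\mathsf{Q}\cap\bigcup_{n\ge0}f^n(\mathsf{J}_0)\Big)$.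 (b) If $|c|=p$, then $\mathsf{J}_0=\emptyset$ and $\mathcal{K}^-\subset\mathsf{C}$. (c) If $|c|>p$, then $\mathcal{K}^-$ is unbounded, and it is a Borel set of infinite Haar measure in $\mathbb{Q}_p^2$. -/

import Mathlib

open MeasureTheory

namespace BackwardJulia

section

variable {p : ℕ} [Fact p.Prime]

/-- The map `f(x, y) = (x y + c, x)` on `ℚ_p²`. -/
noncomputable def f (c : ℚ_[p]) (z : ℚ_[p] × ℚ_[p]) : ℚ_[p] × ℚ_[p] :=
  (z.1 * z.2 + c, z.1)

/-- The formula `f⁻¹(x, y) = (y, (x - c) / y)`; it is the inverse of `f` at points with `y ≠ 0`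
and is only meaningful there (see `f_eq_iff` and `existsUnique_f_eq_iff`). -/
noncomputable def finv (c : ℚ_[p]) (z : ℚ_[p] × ℚ_[p]) : ℚ_[p] × ℚ_[p] :=
  (z.2, (z.1 - c) / z.2)

theorem f_eq_iff (c : ℚ_[p]) {z : ℚ_[p] × ℚ_[p]} (hz : z.2 ≠ 0) (w : ℚ_[p] × ℚ_[p]) :
    f c w = z ↔ w = finv c z := by
  obtain ⟨x, y⟩ := z
  obtain ⟨u, v⟩ := w
  simp only [f, finv, Prod.mk.injEq] at hz ⊢
  constructor
  · rintro ⟨h1, rfl⟩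
    refine ⟨rfl, ?_⟩
    rw [← h1]
    field_simp
    ring
  · rintro ⟨rfl, rfl⟩
    refine ⟨?_, rfl⟩
    field_simp
    ring

theorem existsUnique_f_eq_iff (c : ℚ_[p]) (z : ℚ_[p] × ℚ_[p]) :
    (∃! w, f c w = z) ↔ z.2 ≠ 0 := by
  constructor
  · rintro ⟨⟨u, v⟩, hw, huniq⟩ hz
    obtain ⟨x, y⟩ := z
    simp only [f, Prod.mk.injEq] at hw hz huniq
    obtain ⟨h1, h2⟩ := hw
    have hu : u = 0 := h2.trans hz
    have h := huniq (u, v + 1) ⟨by rw [← h1, hu]; ring, h2⟩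
    simp at h
  · intro hz
    exact ⟨finv c z, (f_eq_iff c hz _).2 rfl, fun w hw => (f_eq_iff c hz w).1 hw⟩

/-- `Q`: the points `(x, y)` all of whose backward iterates `f⁻ⁿ(x, y)` exist, that is, `f⁻¹` is
never applied to a point with second coordinate `0`. -/
def Q (c : ℚ_[p]) : Set (ℚ_[p] × ℚ_[p]) :=
  {z | ∀ n : ℕ, ((finv c)^[n] z).2 ≠ 0}

/-- The backward filled Julia set: points of `Q` whose backward orbit `(f⁻ⁿ(x, y))_{n ≥ 1}` is
bounded (for the maximum norm of the product). -/
def Kminus (c : ℚ_[p]) : Set (ℚ_[p] × ℚ_[p]) :=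
  {z | z ∈ Q c ∧ Bornology.IsBounded (Set.range fun n : ℕ => (finv c)^[n + 1] z)}

/-- The Fibonacci numbers with `F 0 = F 1 = 1`. -/
def F (n : ℕ) : ℕ := Nat.fib (n + 1)

/-- `J₀`. -/
def J0 (c : ℚ_[p]) : Set (ℚ_[p] × ℚ_[p]) :=
  {z | z ∈ Q c ∧ ‖z.1‖ < ‖c‖ ∧ 1 < ‖z.2‖ ∧ ‖z.2‖ < ‖c‖}

/-- `C₀`. -/
def C0 (c : ℚ_[p]) : Set (ℚ_[p] × ℚ_[p]) :=
  {z | z ∈ Q c ∧ ‖z.1‖ < ‖c‖ ∧ (‖z.2‖ = 1 ∨ ‖z.2‖ = ‖c‖)} ∪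
    {z | z ∈ Q c ∧ ‖z.1‖ = ‖c‖ ∧ ‖z.2‖ ≤ ‖c‖}

/-- `C_{2n+1}`, for `n ≥ 0`. -/
def Codd (c : ℚ_[p]) (n : ℕ) : Set (ℚ_[p] × ℚ_[p]) :=
  {z | z ∈ Q c ∧ ‖c‖ ^ F (2 * n) < ‖z.1‖ ∧ ‖z.1‖ ≤ ‖c‖ ^ F (2 * n + 2) ∧
    ‖z.2‖ = (‖c‖⁻¹ * ‖z.1‖ ^ F (2 * n)) ^ (1 / (F (2 * n + 1) : ℝ))}

/-- `C_{2n+2}`, for `n ≥ 0`. -/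
def Ceven (c : ℚ_[p]) (n : ℕ) : Set (ℚ_[p] × ℚ_[p]) :=
  {z | z ∈ Q c ∧ ‖c‖ ^ F (2 * n + 1) < ‖z.1‖ ∧ ‖z.1‖ ≤ ‖c‖ ^ F (2 * n + 3) ∧
    ‖z.2‖ = (‖c‖ * ‖z.1‖ ^ F (2 * n + 1)) ^ (1 / (F (2 * n + 2) : ℝ))}

/-- `D₂`. -/
def D2 (c : ℚ_[p]) : Set (ℚ_[p] × ℚ_[p]) :=
  {z | z ∈ Q c ∧ ‖c‖ < ‖z.1‖ ∧ ‖z.1‖ < ‖c‖ ^ 2 ∧ ‖z.2‖ = ‖c‖}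

/-- `D_{2n+1}`, used for `n ≥ 1` only. -/
def Dodd (c : ℚ_[p]) (n : ℕ) : Set (ℚ_[p] × ℚ_[p]) :=
  {z | z ∈ Q c ∧ ‖c‖ ^ F (2 * n) < ‖z.1‖ ∧ ‖z.1‖ < ‖c‖ ^ F (2 * n + 1) ∧
    ‖z.2‖ = (‖c‖⁻¹ * ‖z.1‖ ^ F (2 * n - 2)) ^ (1 / (F (2 * n - 1) : ℝ))}

/-- `D_{2n+2}`, used for `n ≥ 1` only. -/
def Deven (c : ℚ_[p]) (n : ℕ) : Set (ℚ_[p] × ℚ_[p]) :=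
  {z | z ∈ Q c ∧ ‖c‖ ^ F (2 * n + 1) < ‖z.1‖ ∧ ‖z.1‖ < ‖c‖ ^ F (2 * n + 2) ∧
    ‖z.2‖ = (‖c‖ * ‖z.1‖ ^ F (2 * n - 1)) ^ (1 / (F (2 * n) : ℝ))}

/-- `C`, the union of all `C_i` (`i ≥ 0`) and all `D_i` (`i ≥ 2`). -/
def C (c : ℚ_[p]) : Set (ℚ_[p] × ℚ_[p]) :=
  C0 c ∪ (⋃ n : ℕ, Codd c n ∪ Ceven c n) ∪ D2 c ∪
    ⋃ (n : ℕ) (_ : 1 ≤ n), Dodd c n ∪ Deven c n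

/-- The forward orbit `⋃_{n ≥ 0} fⁿ(J₀)` of `J₀`. -/
def forwardJ0 (c : ℚ_[p]) : Set (ℚ_[p] × ℚ_[p]) :=
  ⋃ n : ℕ, (f c)^[n] '' J0 c

end

end BackwardJulia

/-! Write `aₙ` for the first coordinate of `f⁻ⁿ(x, y)`. The second coordinate is `aₙ₊₁`, and `aₙ₊₁
aₙ₊₂ = aₙ - c`. Since the norm is ultrametric, `rₙ = |aₙ|` satisfies nearly closed multiplicative
relations (`IsOrbitNorm`), so the inclusions in (a) concern real sequences.

A bounded orbit that reaches `r ≤ |c|` stays there (`le_of_le`), and every orbit reaches it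
(`exists_le`). At the entry time, an orbit that never meets `J₀` has norms on `C₁` or `D₂`. Before
it, `rₙ = rₙ₊₁ rₙ₊₂`, so in logarithms to base `|c|` going forward is the Fibonacci map `(x, y) ↦ (x
+ y, x)`, which carries each curve to the next (`OnCurve.step`). Conversely, the norm conditions of
`J₀` are invariant under `f⁻¹`, so orbits entering `J₀` are bounded. (b) holds because no norm lies
strictly between `1` and `p`.

For (c), a unit ball inside `Kminus` is pushed forward by `f`: each image contains the unit ball
about the image of the centre, and the first coordinates of the centres grow geometrically. This
gives infinitely many disjoint translates of one ball. -/

namespace BackwardJulia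

/-! ### Real sequences of orbit norms -/

/-- The relations satisfied by the absolute values along a backward orbit
`aₙ₊₁ aₙ₊₂ = aₙ - c`, `|c| = R`. -/
structure IsOrbitNorm (R : ℝ) (r : ℕ → ℝ) : Prop where
  pos : ∀ n, 0 < r (n + 1)
  mul_eq_of_lt : ∀ n, r n < R → r (n + 1) * r (n + 2) = R
  mul_eq_of_gt : ∀ n, R < r n → r (n + 1) * r (n + 2) = r n
  mul_le_of_le : ∀ n, r n ≤ R → r (n + 1) * r (n + 2) ≤ R

/-- If `r (n + 1) = R q` with `q > 1`, then `r (n + 2) ≤ 1` and `r (n + 3) = r (n + 1) / r (n + 2) ≥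
r (n + 1) q`. Repeating this gives geometric growth along every second index, against the bound. -/
theorem IsOrbitNorm.le_of_le {R B : ℝ} {r : ℕ → ℝ} (h : IsOrbitNorm R r) (hR : 1 < R)
    (hB : ∀ n, r n ≤ B) {n : ℕ} (hn : r n ≤ R) : r (n + 1) ≤ R := by
  by_contra! hlt
  set q := r (n + 1) / R with hq
  have hq1 : 1 < q := (one_lt_div (by linarith)).2 hlt
  have key : ∀ k, r (n + 2 * k) ≤ R ∧ r (n + 1) * q ^ k ≤ r (n + 2 * k + 1) := by
    intro k
    induction k with
    | zero => simpa using hn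
    | succ k ih =>
      obtain ⟨h1, h2⟩ := ih
      set m := n + 2 * k with hm
      have hqk : 1 ≤ q ^ k := one_le_pow₀ hq1.le
      have h3 : r (n + 1) ≤ r (m + 1) :=
        (le_mul_of_one_le_right (by linarith) hqk).trans h2
      have h4 := h.mul_le_of_le m h1
      have h5 := h.mul_eq_of_gt (m + 1) (by linarith)
      have p2 := h.pos (m + 1)
      have h6 : r (m + 2) ≤ 1 := by
        by_contra! h7
        nlinarith
      change r (m + 2) ≤ R ∧ _ ≤ r (m + 3)
      have p3 : 0 < r (m + 3) := h.pos (m + 2)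
      refine ⟨by linarith, ?_⟩
      have h8 : r (m + 1) * r (m + 1) ≤ R * r (m + 3) := by
        calc r (m + 1) * r (m + 1) = (r (m + 1) * r (m + 2)) * r (m + 3) := by
              rw [mul_assoc]; congr 1; exact h5.symm
          _ ≤ R * r (m + 3) := by gcongr
      have h9 : r (m + 1) * q ≤ r (m + 3) := by
        rw [hq, mul_div_assoc', div_le_iff₀ (by linarith)]
        calc r (m + 1) * r (n + 1) ≤ r (m + 1) * r (m + 1) :=
              mul_le_mul_of_nonneg_left h3 (by linarith)
          _ ≤ _ := by linarith
      calc r (n + 1) * q ^ (k + 1) = (r (n + 1) * q ^ k) * q := by ring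
        _ ≤ r (m + 1) * q := by gcongr
        _ ≤ _ := h9
  obtain ⟨k, hk⟩ := pow_unbounded_of_one_lt B hq1
  have h1 := (key k).2
  have h2 := hB (n + 2 * k + 1)
  have h3 : 1 * q ^ k ≤ r (n + 1) * q ^ k := by
    gcongr
    linarith
  linarith

theorem IsOrbitNorm.one_le_of_lt {R B : ℝ} {r : ℕ → ℝ} (h : IsOrbitNorm R r) (hR : 1 < R)
    (hB : ∀ n, r n ≤ B) {n : ℕ} (hn : r n < R) : 1 ≤ r (n + 1) := by
  by_contra! hlt
  have h1 := h.mul_eq_of_lt n hn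
  have h2 : r (n + 2) ≤ R := h.le_of_le hR hB (by linarith : r (n + 1) ≤ R)
  have := h.pos n
  nlinarith

/-- If all terms exceeded `R`, each double step would divide by more than `R`, so the even terms
would tend to `0`. -/
theorem IsOrbitNorm.exists_le {R : ℝ} {r : ℕ → ℝ} (h : IsOrbitNorm R r) (hR : 1 < R) :
    ∃ n, r n ≤ R := by
  by_contra! hall
  have key : ∀ k, r (2 * k) * R ^ k ≤ r 0 := by
    intro k
    induction k with
    | zero => simp
    | succ k ih =>
      have h1 := h.mul_eq_of_gt (2 * k) (hall _)
      have h2 := hall (2 * k + 1)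
      have h3 : 0 < r (2 * k + 2) := h.pos _
      calc r (2 * k + 2) * R ^ (k + 1) = (R * r (2 * k + 2)) * R ^ k := by ring
        _ ≤ (r (2 * k + 1) * r (2 * k + 2)) * R ^ k := by gcongr
        _ ≤ r 0 := by rwa [h1]
  obtain ⟨k, hk⟩ := pow_unbounded_of_one_lt (r 0) hR
  have h1 := key k
  have h2 : 1 * R ^ k ≤ r (2 * k) * R ^ k := by
    gcongr
    linarith [hall (2 * k)]
  linarith

/-! ### The Fibonacci curves in logarithmic coordinates -/

theorem F_pos (n : ℕ) : 0 < F n := Nat.fib_pos.2 n.succ_pos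

theorem F_add_two (n : ℕ) : F (n + 2) = F n + F (n + 1) := Nat.fib_add_two

theorem cast_F_add_two (n : ℕ) : (F (n + 2) : ℝ) = F n + F (n + 1) := by
  rw [F_add_two, Nat.cast_add]

/-- Cassini's identity; it makes the endpoints and slopes of consecutive curves match in
`OnCurve.step`. -/
theorem F_even_mul_F_even (n : ℕ) :
    (F (2 * n) : ℝ) * F (2 * n + 2) = (F (2 * n + 1) : ℝ) ^ 2 + 1 := by
  induction n with
  | zero => norm_num [F, Nat.fib]
  | succ n ih =>
    have e1 := cast_F_add_two (2 * n)
    have e2 := cast_F_add_two (2 * n + 1)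
    have e3 := cast_F_add_two (2 * n + 2)
    rw [show 2 * (n + 1) = 2 * n + 2 from rfl]
    simp only [add_assoc, Nat.reduceAdd] at *
    rw [e3, e2]
    rw [e1] at ih ⊢
    linear_combination ih

/-- The union of the curves `C i`, `i ≥ 1`, and `D i`, `i ≥ 2`, in logarithmic coordinates. -/
def OnCurve (x y : ℝ) : Prop :=
  (1 < x ∧ x < 2 ∧ y = 1) ∨ ∃ n : ℕ,
    ((F (2 * n) : ℝ) < x ∧ x ≤ F (2 * n + 2) ∧ F (2 * n + 1) * y = F (2 * n) * x - 1) ∨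
    ((F (2 * n + 1) : ℝ) < x ∧ x ≤ F (2 * n + 3) ∧
      F (2 * n + 2) * y = F (2 * n + 1) * x + 1) ∨
    ((F (2 * n + 2) : ℝ) < x ∧ x < F (2 * n + 3) ∧ F (2 * n + 1) * y = F (2 * n) * x - 1) ∨
    ((F (2 * n + 3) : ℝ) < x ∧ x < F (2 * n + 4) ∧
      F (2 * n + 2) * y = F (2 * n + 1) * x + 1)

/-- The map sends `C i` into `C (i + 1)` and `D i` into `D (i + 1)`. -/
theorem OnCurve.step {x y : ℝ} (h : OnCurve x y) : OnCurve (x + y) x := by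
  rcases h with ⟨h1, h2, rfl⟩ | ⟨n, h⟩
  · refine Or.inr ⟨0, Or.inr <| Or.inr <| Or.inl ?_⟩
    norm_num [F, Nat.fib]
    constructor <;> linarith
  · right
    have e1 := cast_F_add_two (2 * n)
    have e2 := cast_F_add_two (2 * n + 1)
    have e3 := cast_F_add_two (2 * n + 2)
    have e4 := cast_F_add_two (2 * n + 3)
    have pa : (0 : ℝ) < F (2 * n) := by exact_mod_cast F_pos _
    have pb : (0 : ℝ) < F (2 * n + 1) := by exact_mod_cast F_pos _
    have c1 := F_even_mul_F_even n
    simp only [add_assoc, Nat.reduceAdd] at e1 e2 e3 e4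
    have hm : 2 * (n + 1) = 2 * n + 2 := rfl
    generalize hA : (F (2 * n) : ℝ) = a at *
    generalize hB : (F (2 * n + 1) : ℝ) = b at *
    -- All Fibonacci numbers are now expressed through `a` and `b`, and Cassini reads `a (a + b) =
    -- b² + 1`.
    rw [e1] at c1
    have pab : 0 < a + b := by linarith
    rcases h with ⟨h1, h2, h3⟩ | ⟨h1, h2, h3⟩ | ⟨h1, h2, h3⟩ | ⟨h1, h2, h3⟩
    · refine ⟨n, Or.inr <| Or.inl ?_⟩
      rw [hB, e2, e1]
      rw [e1] at h2
      refine ⟨lt_of_mul_lt_mul_left ?_ pb.le, le_of_mul_le_mul_left ?_ pb, ?_⟩ <;> nlinarith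
    · refine ⟨n + 1, Or.inl ?_⟩
      rw [hm]
      simp only [add_assoc, Nat.reduceAdd]
      rw [e3, e2, e1]
      rw [e2, e1] at h2
      rw [e1] at h3
      refine ⟨lt_of_mul_lt_mul_left ?_ pab.le, le_of_mul_le_mul_left ?_ pab, ?_⟩ <;> nlinarith
    · refine ⟨n, Or.inr <| Or.inr <| Or.inr ?_⟩
      rw [hB, e3, e2, e1]
      rw [e1] at h1
      rw [e2, e1] at h2
      refine ⟨lt_of_mul_lt_mul_left ?_ pb.le, lt_of_mul_lt_mul_left ?_ pb.le, ?_⟩ <;> nlinarith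
    · refine ⟨n + 1, Or.inr <| Or.inr <| Or.inl ?_⟩
      rw [hm]
      simp only [add_assoc, Nat.reduceAdd]
      have e5 := cast_F_add_two (2 * n + 3)
      simp only [add_assoc, Nat.reduceAdd] at e5
      rw [e5, e4, e3, e2, e1] at *
      refine ⟨lt_of_mul_lt_mul_left ?_ pab.le, lt_of_mul_lt_mul_left ?_ pab.le, ?_⟩ <;> nlinarith

/-- Here `n` is the last index before the orbit enters `r ≤ R`, and `hJ` says that the orbit avoids
`J₀`. The induction on `j` runs from time `n` back to the starting point. -/
theorem IsOrbitNorm.onCurve {R B : ℝ} {r : ℕ → ℝ} (h : IsOrbitNorm R r) (hR : 1 < R)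
    (hB : ∀ n, r n ≤ B) (hJ : ∀ n, r n < R → 1 < r (n + 1) → R ≤ r (n + 1)) {n : ℕ}
    (hlt : ∀ k ≤ n, R < r k) (hn : r (n + 1) ≤ R) :
    ∀ j ≤ n, OnCurve (Real.logb R (r (n - j))) (Real.logb R (r (n - j + 1))) := by
  intro j
  induction j with
  | zero =>
    intro _
    have h0 := hlt n le_rfl
    have h1 := h.mul_eq_of_gt n h0
    have p1 := h.pos n
    have p2 : 0 < r (n + 2) := h.pos (n + 1)
    have h2 : r (n + 2) ≤ R := h.le_of_le hR hB hn
    have hlog : Real.logb R (r n) = Real.logb R (r (n + 1)) + Real.logb R (r (n + 2)) := by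
      rw [← h1, Real.logb_mul p1.ne' p2.ne']
    have l0 : 1 < Real.logb R (r n) := by
      rw [Real.lt_logb_iff_rpow_lt hR (by linarith), Real.rpow_one]
      exact h0
    have logR : Real.logb R R = 1 := Real.logb_self_eq_one hR
    -- If `r (n + 1) < R`, then `r (n + 2) > 1`, and avoiding `J₀` forces `r (n + 2) = R`: a point
    -- of `C₁`. If `r (n + 1) = R`, the point is on `D₂`, or is the endpoint of `C₁` when also `r (n
    -- + 2) = R`.
    rcases hn.lt_or_eq with hn | hn
    · have h3 : 1 < r (n + 2) := by nlinarith
      have h4 : r (n + 2) = R := le_antisymm h2 (hJ _ hn h3)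
      rw [h4, logR] at hlog
      have l1 : Real.logb R (r (n + 1)) < 1 := by
        rw [← logR]
        exact Real.logb_lt_logb hR p1 hn
      refine Or.inr ⟨0, Or.inl ?_⟩
      norm_num [F, Nat.fib]
      refine ⟨l0, ?_, ?_⟩ <;> linarith
    · rw [hn, logR] at hlog
      simp only [Nat.sub_zero]
      rw [hn, logR]
      rcases h2.lt_or_eq with h2 | h2
      · have l1 : Real.logb R (r (n + 2)) < 1 := by
          rw [← logR]
          exact Real.logb_lt_logb hR p2 h2
        exact Or.inl ⟨l0, by linarith, rfl⟩
      · rw [h2, logR] at hlog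
        refine Or.inr ⟨0, Or.inl ?_⟩
        norm_num [F, Nat.fib, hlog]
  | succ j ih =>
    intro hj
    have h1 := (ih (by omega)).step
    obtain ⟨m, hm⟩ : ∃ m, n - (j + 1) = m := ⟨_, rfl⟩
    have hm' : n - j = m + 1 := by omega
    rw [hm'] at h1
    rw [hm]
    have h2 := h.mul_eq_of_gt m (hlt m (by omega))
    rwa [← h2, Real.logb_mul (h.pos m).ne' (h.pos (m + 1)).ne']

theorem eq_rpow_of_logb {R Y A k : ℝ} (hR : 1 < R) (hY : 0 < Y) (hA : 0 < A) (hk : 0 < k)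
    (h : k * Real.logb R Y = Real.logb R A) : Y = A ^ (1 / k) := by
  refine Real.logb_injOn_pos hR hY (Real.rpow_pos_of_pos hA _) ?_
  rw [Real.logb_rpow_eq_mul_logb_of_pos hA, ← h]
  field_simp

theorem pow_lt_of_lt_logb {R X : ℝ} (hR : 1 < R) (hX : 0 < X) (m : ℕ)
    (h : (m : ℝ) < Real.logb R X) : R ^ m < X := by
  rwa [Real.lt_logb_iff_rpow_lt hR hX, Real.rpow_natCast] at h

theorem lt_pow_of_logb_lt {R X : ℝ} (hR : 1 < R) (hX : 0 < X) (m : ℕ)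
    (h : Real.logb R X < m) : X < R ^ m := by
  rwa [Real.logb_lt_iff_lt_rpow hR hX, Real.rpow_natCast] at h

theorem le_pow_of_logb_le {R X : ℝ} (hR : 1 < R) (hX : 0 < X) (m : ℕ)
    (h : Real.logb R X ≤ m) : X ≤ R ^ m := by
  rwa [Real.logb_le_iff_le_rpow hR hX, Real.rpow_natCast] at h

/-! ### Backward orbits in `ℚ_p`; parts (a) and (b) -/

section

variable {p : ℕ} [Fact p.Prime] {c : ℚ_[p]}

theorem mem_C_of_onCurve (hc : 1 < ‖c‖) {z : ℚ_[p] × ℚ_[p]} (hz : z ∈ Q c)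
    (h1 : 0 < ‖z.1‖) (h : OnCurve (Real.logb ‖c‖ ‖z.1‖) (Real.logb ‖c‖ ‖z.2‖)) : z ∈ C c := by
  have h2 : 0 < ‖z.2‖ := norm_pos_iff.2 (hz 0)
  have pF : ∀ n, (0 : ℝ) < F n := fun n => by exact_mod_cast F_pos n
  have hc0 : 0 < ‖c‖ := by linarith
  have minus : ∀ m k : ℕ, (F k : ℝ) * Real.logb ‖c‖ ‖z.2‖ = F m * Real.logb ‖c‖ ‖z.1‖ - 1 →
      ‖z.2‖ = (‖c‖⁻¹ * ‖z.1‖ ^ F m) ^ (1 / (F k : ℝ)) := by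
    intro m k e
    refine eq_rpow_of_logb hc h2 (by positivity) (pF _) ?_
    rw [e, Real.logb_mul (by positivity) (by positivity), Real.logb_inv,
      Real.logb_self_eq_one hc, Real.logb_pow]
    ring
  have plus : ∀ m k : ℕ, (F k : ℝ) * Real.logb ‖c‖ ‖z.2‖ = F m * Real.logb ‖c‖ ‖z.1‖ + 1 →
      ‖z.2‖ = (‖c‖ * ‖z.1‖ ^ F m) ^ (1 / (F k : ℝ)) := by
    intro m k e
    refine eq_rpow_of_logb hc h2 (by positivity) (pF _) ?_
    rw [e, Real.logb_mul (by positivity) (by positivity),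
      Real.logb_self_eq_one hc, Real.logb_pow]
    ring
  rcases h with ⟨a, b, e⟩ | ⟨n, ⟨a, b, e⟩ | ⟨a, b, e⟩ | ⟨a, b, e⟩ | ⟨a, b, e⟩⟩
  · refine Or.inl <| Or.inr ⟨hz, ?_, lt_pow_of_logb_lt hc h1 2 (by exact_mod_cast b), ?_⟩
    · simpa using pow_lt_of_lt_logb hc h1 1 (by exact_mod_cast a)
    · refine Real.logb_injOn_pos hc h2 hc0 ?_
      rw [e, Real.logb_self_eq_one hc]
  · exact Or.inl <| Or.inl <| Or.inr <| Set.mem_iUnion.2 ⟨n, Or.inl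
      ⟨hz, pow_lt_of_lt_logb hc h1 _ a, le_pow_of_logb_le hc h1 _ b, minus _ _ e⟩⟩
  · exact Or.inl <| Or.inl <| Or.inr <| Set.mem_iUnion.2 ⟨n, Or.inr
      ⟨hz, pow_lt_of_lt_logb hc h1 _ a, le_pow_of_logb_le hc h1 _ b, plus _ _ e⟩⟩
  · exact Or.inr <| Set.mem_iUnion₂.2 ⟨n + 1, by omega, Or.inl
      ⟨hz, pow_lt_of_lt_logb hc h1 _ a, lt_pow_of_logb_lt hc h1 _ b, minus _ _ e⟩⟩
  · exact Or.inr <| Set.mem_iUnion₂.2 ⟨n + 1, by omega, Or.inr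
      ⟨hz, pow_lt_of_lt_logb hc h1 _ a, lt_pow_of_logb_lt hc h1 _ b, plus _ _ e⟩⟩

theorem finv_iterate_snd (z : ℚ_[p] × ℚ_[p]) (n : ℕ) :
    ((finv c)^[n] z).2 = ((finv c)^[n + 1] z).1 := by
  rw [Function.iterate_succ_apply']
  rfl

theorem fst_mul_fst {z : ℚ_[p] × ℚ_[p]} (hz : z ∈ Q c) (n : ℕ) :
    ((finv c)^[n + 1] z).1 * ((finv c)^[n + 2] z).1 = ((finv c)^[n] z).1 - c := by
  rw [← finv_iterate_snd z (n + 1), ← finv_iterate_snd z n, Function.iterate_succ_apply']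
  exact mul_div_cancel₀ _ (hz n)

theorem norm_sub_of_norm_lt {x y : ℚ_[p]} (h : ‖x‖ < ‖y‖) : ‖x - y‖ = ‖y‖ := by
  rw [← norm_neg, neg_sub, sub_eq_add_neg, Padic.add_eq_max_of_ne (by rw [norm_neg]; exact h.ne'),
    norm_neg, max_eq_left h.le]

theorem norm_sub_of_norm_gt {x y : ℚ_[p]} (h : ‖y‖ < ‖x‖) : ‖x - y‖ = ‖x‖ := by
  rw [norm_sub_rev, norm_sub_of_norm_lt h]

theorem isOrbitNorm {z : ℚ_[p] × ℚ_[p]} (hz : z ∈ Q c) :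
    IsOrbitNorm ‖c‖ fun n => ‖((finv c)^[n] z).1‖ where
  pos n := by
    rw [← finv_iterate_snd]
    exact norm_pos_iff.2 (hz n)
  mul_eq_of_lt n h := by
    rw [← norm_mul, fst_mul_fst hz, norm_sub_of_norm_lt h]
  mul_eq_of_gt n h := by
    rw [← norm_mul, fst_mul_fst hz, norm_sub_of_norm_gt h]
  mul_le_of_le n h := by
    rw [← norm_mul, fst_mul_fst hz, sub_eq_add_neg]
    refine (Padic.nonarchimedean _ _).trans ?_
    rw [norm_neg]
    exact max_le h le_rfl

theorem iterate_mem_Q {z : ℚ_[p] × ℚ_[p]} (hz : z ∈ Q c) (n : ℕ) : (finv c)^[n] z ∈ Q c := by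
  intro m
  rw [← Function.iterate_add_apply]
  exact hz _

/-- `f` collapses the line `x = 0`, but over points of `Q` every backward step has a unique
preimage. -/
theorem f_iterate_eq_iff {z : ℚ_[p] × ℚ_[p]} (hz : z ∈ Q c) (n : ℕ) (w : ℚ_[p] × ℚ_[p]) :
    (f c)^[n] w = z ↔ w = (finv c)^[n] z := by
  induction n generalizing z with
  | zero => rfl
  | succ n ih =>
    rw [Function.iterate_succ_apply', f_eq_iff c (z := z) (hz 0), Function.iterate_succ_apply]
    exact ih (iterate_mem_Q hz 1)

theorem mem_forwardJ0_iff {z : ℚ_[p] × ℚ_[p]} (hz : z ∈ Q c) :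
    z ∈ forwardJ0 c ↔ ∃ n, (finv c)^[n] z ∈ J0 c := by
  simp only [forwardJ0, Set.mem_iUnion, Set.mem_image, f_iterate_eq_iff hz, exists_eq_right]

theorem mem_Q_of_finv {z : ℚ_[p] × ℚ_[p]} (h0 : z.2 ≠ 0) (h : finv c z ∈ Q c) : z ∈ Q c := by
  rintro (_ | n)
  · exact h0
  · exact h n

theorem mem_Kminus_iff {z : ℚ_[p] × ℚ_[p]} :
    z ∈ Kminus c ↔ z ∈ Q c ∧ ∃ N : ℕ, ∀ n, ‖(finv c)^[n + 1] z‖ ≤ N := by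
  refine and_congr_right fun _ => ?_
  rw [isBounded_iff_forall_norm_le]
  simp only [Set.forall_mem_range]
  constructor
  · rintro ⟨B, hB⟩
    obtain ⟨N, hN⟩ := exists_nat_ge B
    exact ⟨N, fun n => (hB n).trans hN⟩
  · rintro ⟨N, hN⟩
    exact ⟨N, hN⟩

theorem mem_Kminus_of_finv {z : ℚ_[p] × ℚ_[p]} (h0 : z.2 ≠ 0) (h : finv c z ∈ Kminus c) :
    z ∈ Kminus c := by
  rw [mem_Kminus_iff] at h ⊢
  obtain ⟨hQ, N, hN⟩ := h
  obtain ⟨M, hM⟩ := exists_nat_ge ‖finv c z‖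
  refine ⟨mem_Q_of_finv h0 hQ, max M N, ?_⟩
  rw [Nat.cast_max]
  rintro (_ | n)
  · exact le_max_of_le_left hM
  · exact le_max_of_le_right (hN n)

theorem mem_Kminus_of_iterate {z : ℚ_[p] × ℚ_[p]} (hz : z ∈ Q c) {n : ℕ}
    (h : (finv c)^[n] z ∈ Kminus c) : z ∈ Kminus c := by
  induction n generalizing z with
  | zero => exact h
  | succ n ih => exact mem_Kminus_of_finv (hz 0) (ih (iterate_mem_Q hz 1) h)

theorem iterate_of_norm_lt {z : ℚ_[p] × ℚ_[p]} (h1 : ‖z.1‖ < ‖c‖)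
    (h2 : 1 < ‖z.2‖) (h3 : ‖z.2‖ < ‖c‖) (n : ℕ) :
    ‖((finv c)^[n] z).1‖ < ‖c‖ ∧ 1 < ‖((finv c)^[n] z).2‖ ∧ ‖((finv c)^[n] z).2‖ < ‖c‖ := by
  induction n with
  | zero => exact ⟨h1, h2, h3⟩
  | succ n ih =>
    obtain ⟨h1, h2, h3⟩ := ih
    rw [Function.iterate_succ_apply']
    simp only [finv, norm_div, norm_sub_of_norm_lt h1]
    exact ⟨h3, (one_lt_div (by linarith)).2 h3, div_lt_self (by linarith) h2⟩

/-- Membership in `Q` is not assumed: the invariant bound `1 < ‖·‖` on second coordinates supplies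
it. -/
theorem mem_Kminus_of_norm_lt {z : ℚ_[p] × ℚ_[p]} (h1 : ‖z.1‖ < ‖c‖)
    (h2 : 1 < ‖z.2‖) (h3 : ‖z.2‖ < ‖c‖) : z ∈ Kminus c := by
  have h := iterate_of_norm_lt h1 h2 h3
  refine ⟨fun n hn => ?_, isBounded_iff_forall_norm_le.2 ⟨‖c‖, ?_⟩⟩
  · have := (h n).2.1
    rw [hn, norm_zero] at this
    linarith
  · rintro _ ⟨n, rfl⟩
    exact max_le (h (n + 1)).1.le (h (n + 1)).2.2.le

theorem forwardJ0_inter_Q_subset : forwardJ0 c ∩ Q c ⊆ Kminus c := by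
  rintro z ⟨hf, hz⟩
  obtain ⟨n, -, h1, h2, h3⟩ := (mem_forwardJ0_iff hz).1 hf
  exact mem_Kminus_of_iterate hz (mem_Kminus_of_norm_lt h1 h2 h3)

theorem Kminus_subset (hc : 1 < ‖c‖) : Kminus c ⊆ C c ∪ (forwardJ0 c ∩ Q c) := by
  intro z hzK
  obtain ⟨hz, N, hN⟩ := mem_Kminus_iff.1 hzK
  by_cases hf : z ∈ forwardJ0 c
  · exact Or.inr ⟨hf, hz⟩
  left
  rw [mem_forwardJ0_iff hz, not_exists] at hf
  have h := isOrbitNorm hz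
  set r : ℕ → ℝ := fun n => ‖((finv c)^[n] z).1‖ with hr
  -- `Kminus` bounds only the iterates with `n ≥ 1`, so index `0` is added by hand.
  have hB : ∀ n, r n ≤ max ‖z.1‖ N := by
    rintro (_ | n)
    · exact le_max_left _ _
    · exact le_max_of_le_right ((norm_fst_le _).trans (hN n))
  have hJ : ∀ n, r n < ‖c‖ → 1 < r (n + 1) → ‖c‖ ≤ r (n + 1) := by
    intro n h1 h2
    by_contra! h3
    refine hf n ⟨iterate_mem_Q hz n, h1, ?_⟩
    rw [finv_iterate_snd]
    exact ⟨h2, h3⟩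
  have r0 : r 0 = ‖z.1‖ := rfl
  have r1 : r 1 = ‖z.2‖ := rfl
  rcases lt_trichotomy ‖z.1‖ ‖c‖ with h0 | h0 | h0
  · refine Or.inl <| Or.inl <| Or.inl <| Or.inl ⟨hz, h0, ?_⟩
    have h1 : 1 ≤ r 1 := h.one_le_of_lt hc hB h0
    have h2 : r 1 ≤ ‖c‖ := h.le_of_le hc hB (n := 0) h0.le
    rcases h1.eq_or_lt with h1 | h1
    · exact Or.inl h1.symm
    · exact Or.inr (le_antisymm h2 (hJ 0 h0 h1))
  · exact Or.inl <| Or.inl <| Or.inl <| Or.inr ⟨hz, h0, h.le_of_le hc hB (n := 0) h0.le⟩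
  · have hex := h.exists_le hc
    classical
    obtain ⟨n, hn⟩ : ∃ n, Nat.find hex = n + 1 := by
      refine Nat.exists_eq_succ_of_ne_zero fun hzero => ?_
      have := Nat.find_spec hex
      rw [hzero] at this
      linarith
    have h1 := Nat.find_spec hex
    rw [hn] at h1
    have h2 : ∀ k ≤ n, ‖c‖ < r k := fun k hk => not_le.1 (Nat.find_min hex (by omega))
    have h3 := h.onCurve hc hB hJ h2 h1 n le_rfl
    rw [Nat.sub_self] at h3
    exact mem_C_of_onCurve hc hz (by linarith) h3

theorem J0_eq_empty (hc : ‖c‖ = (p : ℝ)) : J0 c = ∅ := by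
  refine Set.eq_empty_of_forall_notMem ?_
  rintro z ⟨-, -, h1, h2⟩
  have hp : (1 : ℝ) < p := by exact_mod_cast (Fact.out : p.Prime).one_lt
  have h0 : z.2 ≠ 0 := by
    rintro h
    rw [h, norm_zero] at h1
    linarith
  rw [hc] at h2
  rw [Padic.norm_eq_zpow_neg_valuation h0] at h1 h2
  have h3 := (one_lt_zpow_iff_right₀ hp).1 h1
  have h4 := (zpow_lt_zpow_iff_right₀ hp).1 (h2.trans_eq (zpow_one (p : ℝ)).symm)
  omega

/-! ### Unit balls in `Kminus`; part (c) -/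

theorem norm_eq_of_norm_sub_le_one {x y : ℚ_[p]} (hx : 1 < ‖x‖) (h : ‖y - x‖ ≤ 1) :
    ‖y‖ = ‖x‖ := by
  rw [← sub_add_cancel y x, Padic.add_eq_max_of_ne (by linarith [hx] : _ < _).ne,
    max_eq_right (by linarith)]

/-- `f⁻¹` maps the unit ball about `f c z` into the one about `z`: the error in the second
coordinate is divided by `‖v‖ = ‖x‖`, and `‖y‖ ≤ ‖x‖` absorbs the factor `y`. -/
theorem closedBall_f_subset_Kminus {z : ℚ_[p] × ℚ_[p]} (h1 : 1 < ‖z.1‖) (h2 : ‖z.2‖ ≤ ‖z.1‖)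
    (h : Metric.closedBall z 1 ⊆ Kminus c) : Metric.closedBall (f c z) 1 ⊆ Kminus c := by
  obtain ⟨x, y⟩ := z
  rintro ⟨u, v⟩ hq
  simp only [f, Metric.mem_closedBall, dist_eq_norm, Prod.mk_sub_mk, Prod.norm_mk,
    max_le_iff] at hq h1 h2
  obtain ⟨hu, hv⟩ := hq
  have hvx := norm_eq_of_norm_sub_le_one h1 hv
  have hv0 : v ≠ 0 := by
    rintro rfl
    rw [norm_zero] at hvx
    linarith
  refine mem_Kminus_of_finv hv0 (h ?_)
  simp only [finv, Metric.mem_closedBall, dist_eq_norm, Prod.mk_sub_mk, Prod.norm_mk, max_le_iff]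
  refine ⟨hv, ?_⟩
  have e : (u - c) / v - y = ((u - (x * y + c)) + y * (x - v)) / v := by
    field_simp
    ring
  rw [e, norm_div, hvx]
  refine div_le_one_of_le₀ ((Padic.nonarchimedean _ _).trans (max_le (by linarith) ?_))
    (norm_nonneg _)
  rw [norm_mul, norm_sub_rev]
  calc ‖y‖ * ‖v - x‖ ≤ ‖x‖ * 1 := by gcongr
    _ = ‖x‖ := mul_one _

theorem norm_two_eq_one (hp : Odd p) : ‖(2 : ℚ_[p])‖ = 1 := by
  refine le_antisymm (by simpa using Padic.norm_int_le_one (p := p) 2) (not_lt.1 fun h => ?_)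
  have h' : (p : ℤ) ∣ 2 := (Padic.norm_intCast_lt_one_iff (p := p)).1 (by simpa using h)
  have h2 : p ∣ 2 := by exact_mod_cast h'
  rw [(Nat.prime_dvd_prime_iff_eq Fact.out Nat.prime_two).1 h2] at hp
  exact absurd hp (by decide)

theorem exists_closedBalls_subset_Kminus (hp : Odd p) (hc : (p : ℝ) < ‖c‖) :
    ∃ z : ℕ → ℚ_[p] × ℚ_[p], (∀ n, Metric.closedBall (z n) 1 ⊆ Kminus c) ∧
      ∃ q : ℝ, 1 < q ∧ 1 < ‖(z 0).1‖ ∧ ∀ n, ‖(z n).1‖ * q ≤ ‖(z (n + 1)).1‖ := by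
  have hp1 : (1 : ℝ) < p := by exact_mod_cast (Fact.out : p.Prime).one_lt
  have hp0 : (0 : ℝ) < p := by linarith
  set q : ℝ := ‖c‖ / p with hq
  have hq1 : 1 < q := (one_lt_div hp0).2 hc
  have hqc : q < ‖c‖ := div_lt_self (by linarith) hp1
  have hqp : ‖c‖ / q = p := div_div_cancel₀ (by linarith)
  -- Near `z₀`, `‖u - c‖ = ‖c‖` and `‖v‖ = q`, so `f⁻¹` has coordinate norms `q` and `p`, both
  -- strictly between `1` and `‖c‖`. As `p` is odd, `‖2 * c‖ = ‖c‖`, so `z₀` also satisfies `‖y‖ ≤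
  -- ‖x‖`.
  set z₀ : ℚ_[p] × ℚ_[p] := (2 * c, c * p) with hz₀
  have n1 : ‖2 * c‖ = ‖c‖ := by rw [norm_mul, norm_two_eq_one hp, one_mul]
  have n2 : ‖c * p‖ = q := by rw [norm_mul, Padic.norm_p, hq, div_eq_mul_inv]
  have base : Metric.closedBall z₀ 1 ⊆ Kminus c := by
    rintro ⟨u, v⟩ h
    simp only [hz₀, Metric.mem_closedBall, dist_eq_norm, Prod.mk_sub_mk, Prod.norm_mk,
      max_le_iff] at h
    obtain ⟨hu, hv⟩ := h
    have hv' : ‖v‖ = q := (norm_eq_of_norm_sub_le_one (by linarith) hv).trans n2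
    have hu' : ‖u - c‖ = ‖c‖ := norm_eq_of_norm_sub_le_one (by linarith)
      (by rwa [sub_sub, ← two_mul])
    refine mem_Kminus_of_finv (norm_pos_iff.1 (by rw [hv']; linarith))
      (mem_Kminus_of_norm_lt ?_ ?_ ?_) <;> simp only [finv, norm_div, hu', hv', hqp] <;> assumption
  have key : ∀ n, Metric.closedBall ((f c)^[n] z₀) 1 ⊆ Kminus c ∧ ‖c‖ ≤ ‖((f c)^[n] z₀).1‖ ∧
      q ≤ ‖((f c)^[n] z₀).2‖ ∧ ‖((f c)^[n] z₀).2‖ ≤ ‖((f c)^[n] z₀).1‖ ∧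
      ‖((f c)^[n] z₀).1‖ * q ≤ ‖((f c)^[n + 1] z₀).1‖ := by
    have grow : ∀ w : ℚ_[p] × ℚ_[p], ‖c‖ ≤ ‖w.1‖ → q ≤ ‖w.2‖ →
        ‖w.1‖ * q ≤ ‖(f c w).1‖ := by
      intro w h1 h2
      have h3 : ‖w.1‖ * q ≤ ‖w.1 * w.2‖ := by
        rw [norm_mul]
        gcongr
      have h4 : ‖c‖ < ‖w.1 * w.2‖ := by nlinarith
      rw [f, Padic.add_eq_max_of_ne h4.ne', max_eq_left h4.le]
      exact h3
    intro n
    induction n with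
    | zero =>
      refine ⟨base, n1.ge, n2.ge, ?_, grow _ n1.ge n2.ge⟩
      simp only [Function.iterate_zero, id, hz₀, n1, n2]
      exact hqc.le
    | succ n ih =>
      obtain ⟨h1, h2, h3, h4, h5⟩ := ih
      rw [Function.iterate_succ_apply' (f c) (n + 1)]
      rw [Function.iterate_succ_apply'] at h5 ⊢
      have h6 : ‖((f c)^[n] z₀).1‖ ≤ ‖(f c ((f c)^[n] z₀)).1‖ :=
        (le_mul_of_one_le_right (norm_nonneg _) hq1.le).trans h5
      have h7 : q ≤ ‖(f c ((f c)^[n] z₀)).2‖ := hqc.le.trans h2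
      exact ⟨closedBall_f_subset_Kminus (by linarith) h4 h1, h2.trans h6, h7, h6,
        grow _ (h2.trans h6) h7⟩
  exact ⟨fun n => (f c)^[n] z₀, fun n => (key n).1, q, hq1,
    n1.symm ▸ (by linarith : 1 < ‖c‖), fun n => (key n).2.2.2.2⟩

theorem not_isBounded_Kminus (hp : Odd p) (hc : (p : ℝ) < ‖c‖) :
    ¬ Bornology.IsBounded (Kminus c) := by
  obtain ⟨z, hz, q, hq, h0, hgrow⟩ := exists_closedBalls_subset_Kminus hp hc
  intro hb
  obtain ⟨B, hB⟩ := isBounded_iff_forall_norm_le.1 hb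
  have key : ∀ n, q ^ n ≤ ‖(z n).1‖ := by
    intro n
    induction n with
    | zero => simpa using h0.le
    | succ n ih =>
      calc q ^ (n + 1) = q ^ n * q := pow_succ _ _
        _ ≤ ‖(z n).1‖ * q := by gcongr
        _ ≤ _ := hgrow n
  obtain ⟨n, hn⟩ := pow_unbounded_of_one_lt B hq
  have h1 := hB _ (hz n (Metric.mem_closedBall_self zero_le_one))
  linarith [key n, norm_fst_le (z n)]

/-- Bounds by natural numbers make `Kminus` a countable combination of Borel conditions. -/
theorem measurableSet_Kminus [MeasurableSpace ℚ_[p]] [BorelSpace ℚ_[p]] :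
    MeasurableSet (Kminus c) := by
  have hfinv : Measurable (finv c) :=
    measurable_snd.prodMk ((measurable_fst.sub measurable_const).div measurable_snd)
  have hit : ∀ n, Measurable ((finv c)^[n]) := fun n => hfinv.iterate n
  have e : Kminus c = (⋂ n : ℕ, {z | ((finv c)^[n] z).2 ≠ 0}) ∩
      ⋃ N : ℕ, ⋂ n : ℕ, {z | ‖(finv c)^[n + 1] z‖ ≤ N} := by
    ext z
    simp only [mem_Kminus_iff, Q, Set.mem_ofPred_eq, Set.mem_inter_iff, Set.mem_iInter,
      Set.mem_iUnion]
  rw [e]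
  refine (MeasurableSet.iInter fun n => ?_).inter
    (MeasurableSet.iUnion fun N => MeasurableSet.iInter fun n => ?_)
  · exact (measurable_snd.comp (hit n)) (measurableSet_singleton 0).compl
  · exact measurableSet_le (hit (n + 1)).norm measurable_const

theorem measure_Kminus_eq_top (hp : Odd p) (hc : (p : ℝ) < ‖c‖) [MeasurableSpace ℚ_[p]]
    [BorelSpace ℚ_[p]] (μ : Measure (ℚ_[p] × ℚ_[p])) [μ.IsAddHaarMeasure] :
    μ (Kminus c) = ⊤ := by
  obtain ⟨z, hz, q, hq, h0, hgrow⟩ := exists_closedBalls_subset_Kminus hp hc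
  have hmono : StrictMono fun n => ‖(z n).1‖ := by
    have key : ∀ n, 1 < ‖(z n).1‖ ∧ ‖(z n).1‖ < ‖(z (n + 1)).1‖ := by
      intro n
      induction n with
      | zero => exact ⟨h0, by nlinarith [hgrow 0]⟩
      | succ n ih =>
        have := ih.1.trans ih.2
        exact ⟨this, by nlinarith [hgrow (n + 1)]⟩
    exact strictMono_nat_of_lt_succ fun n => (key n).2
  have h1 : ∀ n, 1 < ‖(z n).1‖ := fun n => h0.trans_le (hmono.monotone n.zero_le)
  -- On each ball `‖w.1‖` is constant, equal to its value at the centre, and these values are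
  -- distinct.
  have hdisj : Pairwise (Function.onFun Disjoint fun n => Metric.closedBall (z n) 1) := by
    intro m n hmn
    refine Set.disjoint_left.2 fun w hm hn => hmn (hmono.injective ?_)
    have aux : ∀ k, w ∈ Metric.closedBall (z k) 1 → ‖w.1‖ = ‖(z k).1‖ := fun k hk =>
      norm_eq_of_norm_sub_le_one (h1 k)
        ((norm_fst_le (w - z k)).trans (mem_closedBall_iff_norm.1 hk))
    exact (aux m hm).symm.trans (aux n hn)
  have hmeas : ∀ n, μ (Metric.closedBall (z n) 1) = μ (Metric.closedBall 0 1) :=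
    fun n => Measure.addHaar_closedBall_center μ (z n) 1
  have hpos : μ (Metric.closedBall 0 1) ≠ 0 :=
    (Metric.measure_closedBall_pos μ 0 one_pos).ne'
  refine top_unique ?_
  calc (⊤ : ENNReal) = ∑' n, μ (Metric.closedBall (z n) 1) := by
        simp only [hmeas]
        exact (ENNReal.tsum_const_eq_top_of_ne_zero hpos).symm
    _ = μ (⋃ n, Metric.closedBall (z n) 1) :=
        (measure_iUnion hdisj fun n => Metric.isClosed_closedBall.measurableSet).symm
    _ ≤ μ (Kminus c) := measure_mono (Set.iUnion_subset hz)

end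

end BackwardJulia

theorem theorem2 {p : ℕ} [Fact p.Prime] (hp : Odd p) (c : ℚ_[p]) (hc : 1 < ‖c‖) :
    ((BackwardJulia.forwardJ0 c ∩ BackwardJulia.Q c ⊆ BackwardJulia.Kminus c) ∧
      (BackwardJulia.Kminus c ⊆
        BackwardJulia.C c ∪ (BackwardJulia.forwardJ0 c ∩ BackwardJulia.Q c))) ∧
    (‖c‖ = (p : ℝ) →
      BackwardJulia.J0 c = ∅ ∧ BackwardJulia.Kminus c ⊆ BackwardJulia.C c) ∧
    ((p : ℝ) < ‖c‖ →
      ¬ Bornology.IsBounded (BackwardJulia.Kminus c) ∧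
      ∀ [MeasurableSpace ℚ_[p]] [BorelSpace ℚ_[p]] (μ₂ : Measure (ℚ_[p] × ℚ_[p]))
        [μ₂.IsAddHaarMeasure],
        MeasurableSet (BackwardJulia.Kminus c) ∧ μ₂ (BackwardJulia.Kminus c) = ⊤) := by
  refine ⟨⟨BackwardJulia.forwardJ0_inter_Q_subset, BackwardJulia.Kminus_subset hc⟩, ?_, ?_⟩
  · intro h
    have hJ := BackwardJulia.J0_eq_empty h
    refine ⟨hJ, (BackwardJulia.Kminus_subset hc).trans ?_⟩
    simp [BackwardJulia.forwardJ0, hJ]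
  · intro h
    refine ⟨BackwardJulia.not_isBounded_Kminus hp h, ?_⟩
    intro _ _ μ₂ _
    exact ⟨BackwardJulia.measurableSet_Kminus, BackwardJulia.measure_Kminus_eq_top hp h μ₂⟩
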